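/- Let $X$ be a finite set. A \emph{polymatroid} on $X$ is a function $h:2^X\to\mathbb R_{\ge 0}$ with $h(\emptyset)=0$, $h(A)\le h(B)$ for $A\subseteq B$, and $h(A\cup B)+h(A\cap B)\le h(A)+h(B)$ for all $A,B\subseteq X$. It is \emph{Ingletonian} if for all $A_1,A_2,A_3,A_4\subseteq X$ \[ \begin{aligned} &h(A_1)+h(A_2)+h(A_3\cup A_4)+h(A_1\cup A_2\cup A_3)+h(A_1\cup A_2\cup A_4)\\ &\quad\le h(A_1\cup A_2)+h(A_1\cup A_3)+h(A_1\cup A_4)+h(A_2\cup A_3)+h(A_2\cup A_4). \end{aligned} \] It is \emph{representable} if there are a finite field $\mathbb F$, a finite-dimensional $\mathbb F$-vector space and subspaces $(V_i)_{i\in X}$ of it with $h(A)=\dim\langle V_i : i\in A\rangle$ for all $A\subseteq X$. It is \emph{cc-representable} if it lies in the closure, in $\mathbb R^{2^X}$, of the convex cone generated by the representable rank functions on $X$. \textbf{Theorem (Insufficiency of Ingleton's inequalities).} (1) There exist a finite set $X$ and an Ingletonian polymatroid on $X$ that is not cc-representable. (2) Consequently, there exist a finite set $X$ and real coefficients $(c_A)_{A\subseteq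 X}$ such that $\sum_{A\subseteq X}c_A h(A)\ge 0$ for every representable polymatroid $h$ on $X$, but this inequality is not implied by Ingleton's inequalities: some Ingletonian polymatroid $h$ on $X$ has $\sum_{A\subseteq X}c_A h(A)<0$. (3) Explicitly, let $u_1,u_2,u_3$ be linearly independent vectors over a finite field of characteristic $2$, and let $\Phi_1$ be the rank function (dimension of the span) of the seven lines spanned by \[u_1,\;u_2,\;u_3,\;u_1+u_2,\;u_2+u_3,\;u_1+u_2+u_3,\;u_1+u_3\] (the Fano matroid). Let $v_1,\dots,v_5$ be linearly independent vectors over a finite field of odd characteristic, and let $\Phi_2$ be the rank function of the thirteen lines spanned by \[v_1,\dots,v_5,\;v_1+v_2+v_3,\;v_3+v_4+v_5,\;v_1+v_2,\;v_1+v_3,\;v_2+v_3,\;v_3+v_4,\;v_3+v_5,\;v_4+v_5\] (the second Dougherty--Freiling--Zeger matroid). Let $X_1,X_2$ be the (disjoint) ground sets of $\Phi_1,\Phi_2$, let $X=X_1\sqcup X_2$, and let $\Phi(A)=\Phi_1(A\cap X_1)+\Phi_2(A\cap X_2)$ be the direct sum. Then for every real $\epsilon$ with $0<\epsilon\le\min(\Phi_1(X_1),\Phi_2(X_2))$,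 the $\epsilon$-perturbation \[\Phi^{\epsilon}(A)=\min\bigl(\Phi(A),\,\Phi(X)-\epsilon\bigr),\qquad A\subseteq X,\] is an Ingletonian polymatroid that is not cc-representable, and there are real coefficients $(c_A)_{A\subseteq X}$ such that $\sum_{A\subseteq X} c_A h(A)\ge 0$ for every representable polymatroid $h$ on $X$ while $\sum_{A\subseteq X} c_A\Phi^{\epsilon}(A)<0$. -/

import Mathlib

open scoped BigOperators

noncomputable section

namespace Polymat

/-- Rank functions over a ground set `X`, viewed as points of the real Euclidean space
whose coordinates are indexed by the subsets of `X`. -/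
abbrev RankFun (X : Type*) := Finset X → ℝ

/-- The polymatroid axioms. -/
structure IsPolymatroid {X : Type*} [DecidableEq X] (h : RankFun X) : Prop where
  nonneg : ∀ A, 0 ≤ h A
  empty : h ∅ = 0
  mono : ∀ A B, A ⊆ B → h A ≤ h B
  submodular : ∀ A B, h (A ∪ B) + h (A ∩ B) ≤ h A + h B

/-- The Ingleton expression `J_h(A₁, A₂, A₃, A₄)`. -/
def ingleton {X : Type*} [DecidableEq X] (h : RankFun X) (A₁ A₂ A₃ A₄ : Finset X) : ℝ :=
  h (A₁ ∪ A₂) + h (A₁ ∪ A₃) + h (A₁ ∪ A₄) + h (A₂ ∪ A₃) + h (A₂ ∪ A₄)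
    - h A₁ - h A₂ - h (A₃ ∪ A₄) - h (A₁ ∪ A₂ ∪ A₃) - h (A₁ ∪ A₂ ∪ A₄)

/-- An Ingletonian polymatroid: a polymatroid satisfying every Ingleton inequality. -/
structure IsIngletonian {X : Type*} [DecidableEq X] (h : RankFun X) : Prop where
  isPolymatroid : IsPolymatroid h
  ingleton_nonneg : ∀ A₁ A₂ A₃ A₄, 0 ≤ ingleton h A₁ A₂ A₃ A₄

/-- The rank function of a family of subspaces: `A ↦ dim ⟨V i, i ∈ A⟩`. -/
def subspaceRank (F : Type*) {W X : Type*} [Field F] [AddCommGroup W] [Module F W]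
    (V : X → Submodule F W) : RankFun X :=
  fun A => (Module.finrank F (⨆ i ∈ A, V i : Submodule F W) : ℝ)

/-- `h` is `q`-representable: it is the rank function of a family of subspaces of a
finite-dimensional vector space over a field with `q` elements. -/
def IsQRepresentable {X : Type*} (q : ℕ) (h : RankFun X) : Prop :=
  ∃ (F : Type) (_ : Field F) (_ : Finite F) (W : Type) (_ : AddCommGroup W) (_ : Module F W)
    (_ : FiniteDimensional F W) (V : X → Submodule F W),
    Nat.card F = q ∧ h = subspaceRank F V

/-- `h` is representable over some finite field. -/
def IsRepresentable {X : Type*} (h : RankFun X) : Prop :=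
  ∃ q : ℕ, IsQRepresentable q h

/-- `h` lies in the closure of the convex cone generated by the representable rank functions. -/
def IsCCRepresentable {X : Type*} (h : RankFun X) : Prop :=
  h ∈ closure (ConvexCone.hull ℝ {g : RankFun X | IsRepresentable g} : Set (RankFun X))

/-- The linear form `∑_A c_A h(A)`; the linear inequality with coefficients `c` says that it
is nonnegative. -/
def linearForm {X : Type*} [Fintype X] (c : Finset X → ℝ) (h : RankFun X) : ℝ :=
  ∑ A : Finset X, c A * h A

/-- The inequality `∑_A c_A h(A) ≥ 0` holds for all representable polymatroids over `X`. -/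
def IsSubspaceRankInequality {X : Type*} [Fintype X] (c : Finset X → ℝ) : Prop :=
  ∀ h : RankFun X, IsRepresentable h → 0 ≤ linearForm c h

/-- The inequality `∑_A c_A h(A) ≥ 0` is implied by Ingleton's inequalities (together with the
polymatroid axioms). -/
def IsImpliedByIngleton {X : Type*} [Fintype X] [DecidableEq X] (c : Finset X → ℝ) : Prop :=
  ∀ h : RankFun X, IsIngletonian h → 0 ≤ linearForm c h

/-- The `ε`-perturbation `A ↦ min (h A) (h X - ε)`. -/
def perturb {X : Type*} [Fintype X] (ε : ℝ) (h : RankFun X) : RankFun X :=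
  fun A => min (h A) (h Finset.univ - ε)

/-- The direct sum `A ↦ h₁ (A ∩ X₁) + h₂ (A ∩ X₂)` over the disjoint union of ground sets. -/
def directSum {X₁ X₂ : Type*} (h₁ : RankFun X₁) (h₂ : RankFun X₂) : RankFun (X₁ ⊕ X₂) :=
  fun A => h₁ A.toLeft + h₂ A.toRight

/-- The ground set `{Y₁, Y₂, Y₃, W₁, …, W₄}`. -/
abbrev Ground₁ := Fin 3 ⊕ Fin 4

/-- The ground set `{Z₁, …, Z₅, V₁, …, V₈}`. -/
abbrev Ground₂ := Fin 5 ⊕ Fin 8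

/-- The vectors spanning `Y₁, Y₂, Y₃` and `W₁, …, W₄`. -/
def vectors₁ {W : Type*} [AddCommGroup W] (u : Fin 3 → W) : Ground₁ → W :=
  Sum.elim u ![u 0 + u 1, u 1 + u 2, u 0 + u 1 + u 2, u 0 + u 2]

/-- The vectors spanning `Z₁, …, Z₅` and `V₁, …, V₈`. -/
def vectors₂ {W : Type*} [AddCommGroup W] (u : Fin 5 → W) : Ground₂ → W :=
  Sum.elim u ![u 0 + u 1 + u 2, u 2 + u 3 + u 4, u 0 + u 1, u 0 + u 2, u 1 + u 2,
    u 2 + u 3, u 2 + u 4, u 3 + u 4]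

/-- `Φ₁`: the Fano matroid when `u` is linearly independent over a field of characteristic 2. -/
def Φ₁ (F : Type*) {W : Type*} [Field F] [AddCommGroup W] [Module F W] (u : Fin 3 → W) :
    RankFun Ground₁ :=
  subspaceRank F fun i => Submodule.span F {vectors₁ u i}

/-- `Φ₂`: the second Dougherty-Freiling-Zeger matroid when `u` is linearly independent over a
field of odd characteristic. -/
def Φ₂ (F : Type*) {W : Type*} [Field F] [AddCommGroup W] [Module F W] (u : Fin 5 → W) :
    RankFun Ground₂ :=
  subspaceRank F fun i => Submodule.span F {vectors₂ u i}

end Polymat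

end

/-!
Let `a, b, c, p, q, r, s` be the points of a putative Fano configuration, with subspaces
`A, B, C, P, Q, R, S`. The triples `(x, y, z) ∈ A × B × C` with `x + y ∈ P`, `y + z ∈ Q`,
`x + z ∈ S` and `x + y + z ∈ R` form a space whose dimension is bounded in two ways. From below:
each condition cuts the dimension by an amount controlled by how far the subspaces are from
satisfying `p = a + b`, `q = b + c`, `s = a + c`, `r = a + b + c`. From above: in characteristic
two `x + y = (y + z) + (x + z)` lies in `P ⊓ (Q ⊔ S)`, whereas otherwise
`2z = (y + z) + (x + z) - (x + y)`, so `z` lies in `C ⊓ (Q ⊔ S)` as soon as `x + y ∈ Q ⊔ S`.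
Comparing the two bounds gives inequalities `h X₁ ≤ S₁ h` over fields with `2 ≠ 0` and
`h X₂ ≤ S₂ h` over fields with `2 = 0`, with `S₁`, `S₂` nonnegative on all polymatroids, while
`S₁ Φ₁ = 0` and `S₂ Φ₂ = 0`.

Every field satisfies one of the two inequalities, so with `hᵢ` the restriction of `h` to `Xᵢ`
the form `h X + (S₁ h₁ - h₁ X₁) + (S₂ h₂ - h₂ X₂)` is nonnegative on all representable `h`. The
perturbation `Φ^ε` restricts to `Φ₁` and `Φ₂` but has total rank `Φ₁ X₁ + Φ₂ X₂ - ε`, so the form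
takes the value `-ε` there. On the other hand Ingleton's inequality survives truncation, so `Φ^ε`
is Ingletonian.
-/

noncomputable section

namespace Polymat

section Dimension

variable {F U W : Type*} [DivisionRing F] [AddCommGroup U] [Module F U] [AddCommGroup W]
  [Module F W]

/-- The dimension of a subspace as a real number, so that differences of dimensions are not
truncated. It is `0` on infinite-dimensional subspaces. -/
def dim (A : Submodule F W) : ℝ := Module.finrank F A

/-- The dimension of `A` modulo `B`, that is, of `(A ⊔ B) ⧸ B`. -/
def condDim (A B : Submodule F W) : ℝ := dim (A ⊔ B) - dim B

@[simp]
theorem dim_bot : dim (⊥ : Submodule F W) = 0 := by simp [dim]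

theorem dim_nonneg (A : Submodule F W) : 0 ≤ dim A := Nat.cast_nonneg _

theorem dim_mono {A B : Submodule F W} [FiniteDimensional F B] (h : A ≤ B) : dim A ≤ dim B :=
  Nat.cast_le.2 (Submodule.finrank_mono h)

theorem dim_sup_add_dim_inf (A B : Submodule F W) [FiniteDimensional F A]
    [FiniteDimensional F B] : dim (A ⊔ B) + dim (A ⊓ B) = dim A + dim B := by
  unfold dim
  exact_mod_cast Submodule.finrank_sup_add_finrank_inf_eq A B

theorem dim_map_add_dim_inf_ker (T : U →ₗ[F] W) (N : Submodule F U) [FiniteDimensional F N] :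
    dim (N.map T) + dim (N ⊓ LinearMap.ker T) = dim N := by
  have hrange : LinearMap.range (T.domRestrict N) = N.map T := by
    rw [LinearMap.domRestrict, LinearMap.range_comp, Submodule.range_subtype]
  have hker : (LinearMap.ker (T.domRestrict N)).map N.subtype = N ⊓ LinearMap.ker T := by
    rw [LinearMap.domRestrict, LinearMap.ker_comp, Submodule.map_comap_subtype]
  rw [dim, dim, dim, ← hrange, ← hker, Submodule.finrank_map_subtype_eq]
  exact_mod_cast (T.domRestrict N).finrank_range_add_finrank_ker

theorem condDim_mono_left {A A' : Submodule F W} (B : Submodule F W) [FiniteDimensional F A']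
    [FiniteDimensional F B] (h : A ≤ A') : condDim A B ≤ condDim A' B :=
  sub_le_sub_right (dim_mono (sup_le_sup_right h B)) _

theorem dim_inf_add_condDim (A B : Submodule F W) [FiniteDimensional F A]
    [FiniteDimensional F B] : dim (A ⊓ B) + condDim A B = dim A := by
  rw [condDim]
  linarith [dim_sup_add_dim_inf A B]

theorem dim_le_dim_inf_comap_add_condDim {T : U →ₗ[F] W} {N : Submodule F U}
    {E : Submodule F W} [FiniteDimensional F N] [FiniteDimensional F E] (h : N ≤ E.comap T)
    (B : Submodule F W) [FiniteDimensional F B] :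
    dim N ≤ dim (N ⊓ B.comap T) + condDim E B := by
  have hN' : FiniteDimensional F (N ⊓ B.comap T : Submodule F U) :=
    Submodule.finiteDimensional_of_le inf_le_left
  have hmap : (N ⊓ B.comap T).map T = N.map T ⊓ B := Submodule.map_inf_eq_map_inf_comap.symm
  have hker : N ⊓ B.comap T ⊓ LinearMap.ker T = N ⊓ LinearMap.ker T := by
    rw [inf_assoc, inf_eq_right.2 (LinearMap.ker_le_comap T)]
  have hsub := dim_map_add_dim_inf_ker T (N ⊓ B.comap T)
  rw [hmap, hker] at hsub
  linarith [dim_map_add_dim_inf_ker T N, dim_inf_add_condDim (N.map T) B,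
    condDim_mono_left B (Submodule.map_le_iff_le_comap.2 h)]

theorem dim_le_dim_inf_ker_add_dim {T : U →ₗ[F] W} {N : Submodule F U} {E : Submodule F W}
    [FiniteDimensional F N] [FiniteDimensional F E] (h : N ≤ E.comap T) :
    dim N ≤ dim (N ⊓ LinearMap.ker T) + dim E := by
  rw [← dim_map_add_dim_inf_ker T N]
  linarith [dim_mono (Submodule.map_le_iff_le_comap.2 h)]

theorem condDim_inf_sup_le (C E P : Submodule F W) [FiniteDimensional F C]
    [FiniteDimensional F E] [FiniteDimensional F P] :
    condDim (E ⊓ (C ⊔ P)) P ≤ condDim P E + dim (C ⊓ E) := by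
  have hle : E ⊓ (C ⊔ P) ⊔ P ≤ (P ⊔ E) ⊓ (C ⊔ P) :=
    sup_le (inf_le_inf_right _ le_sup_right) (le_inf le_sup_left le_sup_right)
  have hsup : C ⊔ E ≤ (P ⊔ E) ⊔ (C ⊔ P) :=
    sup_le (le_sup_left.trans le_sup_right) (le_sup_right.trans le_sup_left)
  rw [condDim, condDim]
  linarith [dim_mono hle, dim_mono hsup, dim_sup_add_dim_inf (P ⊔ E) (C ⊔ P),
    dim_sup_add_dim_inf C P, dim_sup_add_dim_inf C E, dim_nonneg (C ⊓ P)]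

theorem dim_le_dim_inf_comap_of_add_mem {f g : U →ₗ[F] W} {N : Submodule F U}
    {C E R : Submodule F W} (P : Submodule F W) [FiniteDimensional F N] [FiniteDimensional F C]
    [FiniteDimensional F E] [FiniteDimensional F R] [FiniteDimensional F P]
    (hf : ∀ w ∈ N, f w ∈ E) (hg : ∀ w ∈ N, g w ∈ C) (hfg : ∀ w ∈ N, f w + g w ∈ R) :
    dim N ≤ dim (N ⊓ P.comap f) + condDim R (C ⊔ P) + condDim P E + dim (C ⊓ E) := by
  have hfgN : N ≤ R.comap (f + g) := hfg
  let N' := N ⊓ (C ⊔ P).comap (f + g)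
  have hfN' : N' ≤ (E ⊓ (C ⊔ P)).comap f := fun w hw =>
    ⟨hf w hw.1, (Submodule.add_mem_iff_left _ (le_sup_left (b := P) (hg w hw.1))).1 hw.2⟩
  have hN' : FiniteDimensional F N' := Submodule.finiteDimensional_of_le inf_le_left
  have hNP : FiniteDimensional F (N ⊓ P.comap f : Submodule F U) :=
    Submodule.finiteDimensional_of_le inf_le_left
  have hmono : dim (N' ⊓ P.comap f) ≤ dim (N ⊓ P.comap f) :=
    dim_mono (inf_le_inf_right _ inf_le_left)
  linarith [dim_le_dim_inf_comap_add_condDim hfgN (C ⊔ P),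
    dim_le_dim_inf_comap_add_condDim hfN' P, condDim_inf_sup_le C E P]

end Dimension

section SubspaceRank

variable {F W X : Type*} [Field F] [AddCommGroup W] [Module F W]

theorem dim_sup_sup_add_dim_inf_sup_le (A B E : Submodule F W) [FiniteDimensional F A]
    [FiniteDimensional F B] [FiniteDimensional F E] :
    dim (A ⊔ B ⊔ E) + dim (A ⊓ B ⊔ E) ≤ dim (A ⊔ E) + dim (B ⊔ E) := by
  rw [sup_sup_distrib_right, ← dim_sup_add_dim_inf (A ⊔ E) (B ⊔ E)]
  gcongr
  exact dim_mono (le_inf (sup_le_sup_right inf_le_left _) (sup_le_sup_right inf_le_right _))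

theorem dim_ingleton_le (A B C D : Submodule F W) [FiniteDimensional F A]
    [FiniteDimensional F B] [FiniteDimensional F C] [FiniteDimensional F D] :
    dim A + dim B + dim (C ⊔ D) + dim (A ⊔ B ⊔ C) + dim (A ⊔ B ⊔ D) ≤
      dim (A ⊔ B) + dim (A ⊔ C) + dim (A ⊔ D) + dim (B ⊔ C) + dim (B ⊔ D) := by
  have hinf : dim (A ⊓ B) ≤ dim ((A ⊓ B ⊔ C) ⊓ (A ⊓ B ⊔ D)) :=
    dim_mono (le_inf le_sup_left le_sup_left)
  have hsup : dim (C ⊔ D) ≤ dim ((A ⊓ B ⊔ C) ⊔ (A ⊓ B ⊔ D)) :=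
    dim_mono (sup_le_sup le_sup_right le_sup_right)
  linarith [dim_sup_add_dim_inf A B, dim_sup_add_dim_inf (A ⊓ B ⊔ C) (A ⊓ B ⊔ D),
    dim_sup_sup_add_dim_inf_sup_le A B C, dim_sup_sup_add_dim_inf_sup_le A B D]

theorem subspaceRank_eq (V : X → Submodule F W) (A : Finset X) :
    subspaceRank F V A = dim (A.sup V) := by
  rw [subspaceRank, dim, Finset.sup_eq_iSup]

theorem isPolymatroid_subspaceRank [DecidableEq X] (V : X → Submodule F W)
    [∀ i, FiniteDimensional F (V i)] : IsPolymatroid (subspaceRank F V) where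
  nonneg A := Nat.cast_nonneg _
  empty := by simp [subspaceRank_eq]
  mono A B h := by
    rw [subspaceRank_eq, subspaceRank_eq]
    exact dim_mono (Finset.sup_mono h)
  submodular A B := by
    simp only [subspaceRank_eq, Finset.sup_union, ← dim_sup_add_dim_inf (A.sup V) (B.sup V)]
    gcongr
    exact dim_mono (le_inf (Finset.sup_mono Finset.inter_subset_left)
      (Finset.sup_mono Finset.inter_subset_right))

theorem isIngletonian_subspaceRank [DecidableEq X] (V : X → Submodule F W)
    [∀ i, FiniteDimensional F (V i)] : IsIngletonian (subspaceRank F V) where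
  isPolymatroid := isPolymatroid_subspaceRank V
  ingleton_nonneg A B C D := by
    simp only [ingleton, subspaceRank_eq, Finset.sup_union]
    linarith [dim_ingleton_le (A.sup V) (B.sup V) (C.sup V) (D.sup V)]

end SubspaceRank

section DirectSum

variable {X₁ X₂ : Type*} {h₁ : RankFun X₁} {h₂ : RankFun X₂} [DecidableEq X₁] [DecidableEq X₂]

theorem IsPolymatroid.directSum (H₁ : IsPolymatroid h₁) (H₂ : IsPolymatroid h₂) :
    IsPolymatroid (directSum h₁ h₂) where
  nonneg A := add_nonneg (H₁.nonneg _) (H₂.nonneg _)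
  empty := by
    have hleft : (∅ : Finset (X₁ ⊕ X₂)).toLeft = ∅ := by ext; simp
    have hright : (∅ : Finset (X₁ ⊕ X₂)).toRight = ∅ := by ext; simp
    rw [Polymat.directSum, hleft, hright, H₁.empty, H₂.empty, add_zero]
  mono A B h := add_le_add (H₁.mono _ _ (Finset.toLeft_subset_toLeft h))
    (H₂.mono _ _ (Finset.toRight_subset_toRight h))
  submodular A B := by
    simp only [Polymat.directSum, Finset.toLeft_union, Finset.toRight_union,
      Finset.toLeft_inter, Finset.toRight_inter]
    linarith [H₁.submodular A.toLeft B.toLeft, H₂.submodular A.toRight B.toRight]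

theorem IsIngletonian.directSum (H₁ : IsIngletonian h₁) (H₂ : IsIngletonian h₂) :
    IsIngletonian (directSum h₁ h₂) where
  isPolymatroid := H₁.isPolymatroid.directSum H₂.isPolymatroid
  ingleton_nonneg A B C D := by
    have hleft := H₁.ingleton_nonneg A.toLeft B.toLeft C.toLeft D.toLeft
    have hright := H₂.ingleton_nonneg A.toRight B.toRight C.toRight D.toRight
    simp only [ingleton, Polymat.directSum, Finset.toLeft_union, Finset.toRight_union] at *
    linarith

end DirectSum

section Truncation

variable {X : Type*} [DecidableEq X] {h : RankFun X}

theorem IsPolymatroid.truncate (H : IsPolymatroid h) {t : ℝ} (ht : 0 ≤ t) :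
    IsPolymatroid fun A => min (h A) t where
  nonneg A := le_min (H.nonneg A) ht
  empty := by rw [H.empty, min_eq_left ht]
  mono A B hAB := min_le_min_right _ (H.mono A B hAB)
  submodular A B := by
    have hinter_left : min (h (A ∩ B)) t ≤ min (h A) t :=
      min_le_min_right t (H.mono _ _ Finset.inter_subset_left)
    have hinter_right : min (h (A ∩ B)) t ≤ min (h B) t :=
      min_le_min_right t (H.mono _ _ Finset.inter_subset_right)
    rcases min_choice (h A) t with hA | hA
    · rcases min_choice (h B) t with hB | hB
      · linarith [H.submodular A B, min_le_left (h (A ∪ B)) t, min_le_left (h (A ∩ B)) t]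
      · linarith [min_le_right (h (A ∪ B)) t]
    · linarith [min_le_right (h (A ∪ B)) t]

theorem IsPolymatroid.add_union_union_le (H : IsPolymatroid h) (A B C : Finset X) :
    h A + h (A ∪ B ∪ C) ≤ h (A ∪ B) + h (A ∪ C) := by
  have hmono : h A ≤ h ((A ∪ B) ∩ (A ∪ C)) :=
    H.mono _ _ (Finset.subset_inter Finset.subset_union_left Finset.subset_union_left)
  have hsub := H.submodular (A ∪ B) (A ∪ C)
  rw [← Finset.union_union_distrib_left, ← Finset.union_assoc] at hsub
  linarith

theorem ingleton_comm_left (h : RankFun X) (A B C D : Finset X) :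
    ingleton h A B C D = ingleton h B A C D := by
  rw [ingleton, ingleton, Finset.union_comm B A]
  ring

theorem ingleton_comm_right (h : RankFun X) (A B C D : Finset X) :
    ingleton h A B C D = ingleton h A B D C := by
  rw [ingleton, ingleton, Finset.union_comm D C]
  ring

theorem IsPolymatroid.ingleton_nonneg_of_union_left_spans (H : IsPolymatroid h)
    {A B C : Finset X} (hle : h (A ∪ B ∪ C) ≤ h (A ∪ B)) (D : Finset X) :
    0 ≤ ingleton h A B C D := by
  have hACD := H.add_union_union_le A C D
  have hBCD := H.add_union_union_le B C D
  have hCD := H.add_union_union_le (C ∪ D) A B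
  rw [show C ∪ D ∪ A = A ∪ C ∪ D by grind, show C ∪ D ∪ B = B ∪ C ∪ D by grind] at hCD
  have hABD : h (A ∪ B ∪ D) ≤ h (A ∪ C ∪ D ∪ B) := H.mono _ _ (by grind)
  rw [ingleton]
  linarith

theorem IsPolymatroid.ingleton_nonneg_of_union_right_spans (H : IsPolymatroid h)
    {A B C : Finset X} (hle : h (A ∪ B ∪ C) ≤ h (A ∪ C)) (D : Finset X) :
    0 ≤ ingleton h A B C D := by
  have hABD := H.add_union_union_le A B D
  have hBCD := H.add_union_union_le B C D
  have hCD : h (C ∪ D) ≤ h (B ∪ C ∪ D) := H.mono _ _ (by grind)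
  rw [ingleton]
  linarith

theorem IsIngletonian.truncate (H : IsIngletonian h) {t : ℝ} (ht : 0 ≤ t) :
    IsIngletonian fun A => min (h A) t where
  isPolymatroid := H.isPolymatroid.truncate ht
  ingleton_nonneg A B C D := by
    -- Each of the five pairs with positive sign either reaches `t`, and then spans the truncation,
    -- or is unchanged. If all are unchanged, truncation only decreases the subtracted terms.
    have P := H.isPolymatroid.truncate ht
    have spans {E : Finset X} (hE : min (h E) t = t) (E' : Finset X) :
        min (h E') t ≤ min (h E) t := (min_le_right _ _).trans_eq hE.symm
    rcases (min_choice (h (A ∪ B)) t).symm with hAB | hAB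
    · exact P.ingleton_nonneg_of_union_left_spans (spans hAB _) _
    rcases (min_choice (h (A ∪ C)) t).symm with hAC | hAC
    · exact P.ingleton_nonneg_of_union_right_spans (spans hAC _) _
    rcases (min_choice (h (A ∪ D)) t).symm with hAD | hAD
    · rw [ingleton_comm_right]
      exact P.ingleton_nonneg_of_union_right_spans (spans hAD _) _
    rcases (min_choice (h (B ∪ C)) t).symm with hBC | hBC
    · rw [ingleton_comm_left]
      exact P.ingleton_nonneg_of_union_right_spans (spans hBC _) _
    rcases (min_choice (h (B ∪ D)) t).symm with hBD | hBD
    · rw [ingleton_comm_left, ingleton_comm_right]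
      exact P.ingleton_nonneg_of_union_right_spans (spans hBD _) _
    have hI := H.ingleton_nonneg A B C D
    simp only [ingleton, hAB, hAC, hAD, hBC, hBD] at hI ⊢
    linarith [min_le_left (h A) t, min_le_left (h B) t, min_le_left (h (C ∪ D)) t,
      min_le_left (h (A ∪ B ∪ C)) t, min_le_left (h (A ∪ B ∪ D)) t]

theorem IsIngletonian.perturb [Fintype X] (H : IsIngletonian h) {ε : ℝ}
    (hε : ε ≤ h Finset.univ) : IsIngletonian (perturb ε h) :=
  H.truncate (sub_nonneg.2 hε)

end Truncation

section ApproximateSums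

variable {F U W : Type*} [DivisionRing F] [AddCommGroup U] [Module F U] [FiniteDimensional F U]
  [AddCommGroup W] [Module F W] {x y z : U →ₗ[F] W} {A B C P Q R S : Submodule F W}

/-- The vectors at which the sums `x + y`, `y + z`, `x + y + z` and `x + z` lie in `P`, `Q`, `R`
and `S`. For the coordinates `x`, `y`, `z` of `A × B × C` its dimension measures how close
`P`, `Q`, `R`, `S` are to being spanned by such sums. -/
def sumSpace (x y z : U →ₗ[F] W) (P Q R S : Submodule F W) : Submodule F U :=
  R.comap (x + y + z) ⊓ P.comap (x + y) ⊓ Q.comap (y + z) ⊓ S.comap (x + z)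

theorem finrank_le_dim_sumSpace_add [FiniteDimensional F A] [FiniteDimensional F B]
    [FiniteDimensional F C] [FiniteDimensional F P] [FiniteDimensional F Q]
    [FiniteDimensional F R] [FiniteDimensional F S] (hx : ∀ w, x w ∈ A) (hy : ∀ w, y w ∈ B)
    (hz : ∀ w, z w ∈ C) :
    (Module.finrank F U : ℝ) ≤ dim (sumSpace x y z P Q R S) + condDim (A ⊔ B ⊔ C) R +
      (condDim R (C ⊔ P) + condDim P (A ⊔ B) + dim (C ⊓ (A ⊔ B))) +
      (condDim R (A ⊔ Q) + condDim Q (B ⊔ C) + dim (A ⊓ (B ⊔ C))) +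
      (condDim R (B ⊔ S) + condDim S (A ⊔ C) + dim (B ⊓ (A ⊔ C))) := by
  have hxy (w) : x w + y w ∈ A ⊔ B := Submodule.add_mem_sup (hx w) (hy w)
  have hyz (w) : y w + z w ∈ B ⊔ C := Submodule.add_mem_sup (hy w) (hz w)
  have hxz (w) : x w + z w ∈ A ⊔ C := Submodule.add_mem_sup (hx w) (hz w)
  have hxyz : (⊤ : Submodule F U) ≤ (A ⊔ B ⊔ C).comap (x + y + z) := fun w _ =>
    Submodule.add_mem_sup (hxy w) (hz w)
  let N₁ := R.comap (x + y + z)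
  let N₂ := N₁ ⊓ P.comap (x + y)
  let N₃ := N₂ ⊓ Q.comap (y + z)
  have hN₁ (w) (hw : w ∈ N₁) : x w + y w + z w ∈ R := hw
  have hN₂ (w) (hw : w ∈ N₂) : y w + z w + x w ∈ R := by
    convert hN₁ w hw.1 using 1
    abel
  have hN₃ (w) (hw : w ∈ N₃) : x w + z w + y w ∈ R := by
    convert hN₁ w hw.1.1 using 1
    abel
  have hP := dim_le_dim_inf_comap_of_add_mem (f := x + y) P (fun w _ => hxy w)
    (fun w _ => hz w) hN₁
  have hQ := dim_le_dim_inf_comap_of_add_mem (f := y + z) Q (fun w _ => hyz w)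
    (fun w _ => hx w) hN₂
  have hS := dim_le_dim_inf_comap_of_add_mem (f := x + z) S (fun w _ => hxz w)
    (fun w _ => hy w) hN₃
  have hU := dim_le_dim_inf_comap_add_condDim hxyz R
  rw [top_inf_eq, dim, finrank_top] at hU
  change _ ≤ dim (N₃ ⊓ S.comap (x + z)) + _ + _ + _ + _
  linarith

theorem dim_sumSpace_le_of_two_eq_zero [FiniteDimensional F A] [FiniteDimensional F P]
    [FiniteDimensional F R] (h2 : (2 : F) = 0) (hx : ∀ w, x w ∈ A) (hy : ∀ w, y w ∈ B)
    (hz : ∀ w, z w ∈ C) (hinj : LinearMap.ker x ⊓ LinearMap.ker y ⊓ LinearMap.ker z = ⊥) :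
    dim (sumSpace x y z P Q R S) ≤ dim (P ⊓ (Q ⊔ S)) + dim (R ⊓ C) + dim (A ⊓ B) := by
  set N := sumSpace x y z P Q R S
  have hxy : N ≤ (P ⊓ (Q ⊔ S)).comap (x + y) := by
    rintro w ⟨⟨⟨-, hP⟩, hQ⟩, hS⟩
    have hsum : y w + z w + (x w + z w) = x w + y w := by
      have h2z : z w + z w = 0 := by rw [← two_smul F, h2, zero_smul]
      rw [← add_zero (x w + y w), ← h2z]
      abel
    exact ⟨hP, show x w + y w ∈ Q ⊔ S from hsum ▸ Submodule.add_mem_sup hQ hS⟩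
  have hzRC : N ⊓ LinearMap.ker (x + y) ≤ (R ⊓ C).comap z := by
    rintro w ⟨⟨⟨⟨hR, -⟩, -⟩, -⟩, hw⟩
    have hR' : x w + y w + z w ∈ R := hR
    rw [show x w + y w = 0 from hw, zero_add] at hR'
    exact ⟨hR', hz w⟩
  have hxAB : N ⊓ LinearMap.ker (x + y) ⊓ LinearMap.ker z ≤ (A ⊓ B).comap x := by
    rintro w ⟨⟨-, hw⟩, -⟩
    have hneg : x w = -y w := eq_neg_of_add_eq_zero_left hw
    exact ⟨hx w, show x w ∈ B from hneg ▸ neg_mem (hy w)⟩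
  have hbot : N ⊓ LinearMap.ker (x + y) ⊓ LinearMap.ker z ⊓ LinearMap.ker x = ⊥ := by
    rw [eq_bot_iff, ← hinj]
    rintro w ⟨⟨⟨-, hw⟩, hwz⟩, hwx⟩
    have hwx' : x w = 0 := hwx
    have hw' : x w + y w = 0 := hw
    rw [hwx', zero_add] at hw'
    exact ⟨⟨hwx, hw'⟩, hwz⟩
  have := dim_le_dim_inf_ker_add_dim hxAB
  rw [hbot, dim_bot] at this
  linarith [dim_le_dim_inf_ker_add_dim hxy, dim_le_dim_inf_ker_add_dim hzRC]

theorem dim_sumSpace_le_of_two_ne_zero [FiniteDimensional F A] [FiniteDimensional F B]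
    [FiniteDimensional F C] [FiniteDimensional F P] [FiniteDimensional F Q]
    [FiniteDimensional F S] (h2 : (2 : F) ≠ 0) (hx : ∀ w, x w ∈ A) (hy : ∀ w, y w ∈ B)
    (hz : ∀ w, z w ∈ C) (hinj : LinearMap.ker x ⊓ LinearMap.ker y ⊓ LinearMap.ker z = ⊥) :
    dim (sumSpace x y z P Q R S) ≤
      condDim P (Q ⊔ S) + dim (C ⊓ (Q ⊔ S)) + dim (B ⊓ Q) + dim (A ⊓ S) := by
  set K := sumSpace x y z P Q R S
  let N := K ⊓ (Q ⊔ S).comap (x + y)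
  have hxyP : K ≤ P.comap (x + y) := fun w hw => hw.1.1.2
  have hyzQ : N ≤ Q.comap (y + z) := fun w hw => hw.1.1.2
  have hxzS : N ≤ S.comap (x + z) := fun w hw => hw.1.2
  have hzQS : N ≤ (C ⊓ (Q ⊔ S)).comap z := by
    refine fun w hw => ⟨hz w, (Submodule.smul_mem_iff _ h2).1 ?_⟩
    have hsum : (2 : F) • z w = (y w + z w) + (x w + z w) - (x w + y w) := by
      rw [two_smul]
      abel
    exact hsum ▸ sub_mem (Submodule.add_mem_sup (hyzQ hw) (hxzS hw)) hw.2
  have hyBQ : N ⊓ LinearMap.ker z ≤ (B ⊓ Q).comap y := by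
    rintro w ⟨hw, hwz⟩
    have hQ : y w + z w ∈ Q := hyzQ hw
    rw [show z w = 0 from hwz, add_zero] at hQ
    exact ⟨hy w, hQ⟩
  have hxAS : N ⊓ LinearMap.ker z ⊓ LinearMap.ker y ≤ (A ⊓ S).comap x := by
    rintro w ⟨⟨hw, hwz⟩, -⟩
    have hS : x w + z w ∈ S := hxzS hw
    rw [show z w = 0 from hwz, add_zero] at hS
    exact ⟨hx w, hS⟩
  have hbot : N ⊓ LinearMap.ker z ⊓ LinearMap.ker y ⊓ LinearMap.ker x = ⊥ := by
    rw [eq_bot_iff, ← hinj]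
    exact fun w hw => ⟨⟨hw.2, hw.1.2⟩, hw.1.1.2⟩
  have := dim_le_dim_inf_ker_add_dim hxAS
  rw [hbot, dim_bot] at this
  linarith [dim_le_dim_inf_comap_add_condDim hxyP (Q ⊔ S), dim_le_dim_inf_ker_add_dim hzQS,
    dim_le_dim_inf_ker_add_dim hyBQ]

end ApproximateSums

section Defects

variable {X : Type*}

/-- Evaluation of rank functions at `A`, as a linear form. -/
def rankAt (A : Finset X) : RankFun X →ₗ[ℝ] ℝ := LinearMap.proj A

variable [DecidableEq X]

/-- The rank of `A` given `B`, as a linear form in the rank function. On a polymatroid it is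
nonnegative and measures the failure of `A` to be spanned by `B`. -/
def condRank (A B : Finset X) : RankFun X →ₗ[ℝ] ℝ :=
  rankAt (A ∪ B) - rankAt B

/-- The mutual rank of `A` and `B`, as a linear form in the rank function. On a polymatroid it is
nonnegative and measures the failure of `A` and `B` to be independent. -/
def mutualRank (A B : Finset X) : RankFun X →ₗ[ℝ] ℝ :=
  rankAt A + rankAt B - rankAt (A ∪ B)

/-- The failure of `p = a + b` and `r = c + p` to hold in general position. -/
def sumDefect (a b c p r : X) : RankFun X →ₗ[ℝ] ℝ :=
  condRank {r} {c, p} + condRank {p} {a, b} + mutualRank {c} {a, b}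

/-- The failure of `p = a + b`, `q = b + c`, `s = a + c` and `r = a + b + c` to hold with
independent `a`, `b`, `c`. -/
def configDefect (a b c p q r s : X) : RankFun X →ₗ[ℝ] ℝ :=
  sumDefect a b c p r + sumDefect b c a q r + sumDefect a c b s r +
    (condRank {a} {b, c, r} + condRank {b} {a, c, r} + condRank {c} {a, b, r})

/-- The failure of `a, …, s` to form a Fano configuration, in which `p`, `q`, `s` are collinear. -/
def fanoDefect (a b c p q r s : X) : RankFun X →ₗ[ℝ] ℝ :=
  configDefect a b c p q r s +
    (condRank {p} {q, s} + mutualRank {c} {q, s} + mutualRank {b} {q} + mutualRank {a} {s})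

/-- The failure of `a, …, s` to form a non-Fano configuration, in which `p`, `q`, `s` are
independent. -/
def nonFanoDefect (a b c p q r s : X) : RankFun X →ₗ[ℝ] ℝ :=
  configDefect a b c p q r s + (mutualRank {p} {q, s} + mutualRank {r} {c} + mutualRank {a} {b})

@[simp]
theorem condRank_apply (A B : Finset X) (h : RankFun X) : condRank A B h = h (A ∪ B) - h B := rfl

@[simp]
theorem mutualRank_apply (A B : Finset X) (h : RankFun X) :
    mutualRank A B h = h A + h B - h (A ∪ B) := rfl

namespace IsPolymatroid

variable {h : RankFun X} (H : IsPolymatroid h)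

include H

theorem union_le (A B : Finset X) : h (A ∪ B) ≤ h A + h B := by
  linarith [H.submodular A B, H.nonneg (A ∩ B)]

theorem insert_le (x : X) (A : Finset X) : h (insert x A) ≤ h {x} + h A :=
  H.union_le {x} A

theorem condRank_nonneg (A B : Finset X) : 0 ≤ condRank A B h :=
  sub_nonneg.2 (H.mono _ _ Finset.subset_union_right)

theorem mutualRank_nonneg (A B : Finset X) : 0 ≤ mutualRank A B h :=
  sub_nonneg.2 (H.union_le A B)

theorem sumDefect_nonneg (a b c p r : X) : 0 ≤ sumDefect a b c p r h :=
  add_nonneg (add_nonneg (H.condRank_nonneg _ _) (H.condRank_nonneg _ _))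
    (H.mutualRank_nonneg _ _)

theorem configDefect_nonneg (a b c p q r s : X) : 0 ≤ configDefect a b c p q r s h :=
  add_nonneg (add_nonneg (add_nonneg (H.sumDefect_nonneg _ _ _ _ _) (H.sumDefect_nonneg _ _ _ _ _))
    (H.sumDefect_nonneg _ _ _ _ _)) (add_nonneg (add_nonneg (H.condRank_nonneg _ _)
      (H.condRank_nonneg _ _)) (H.condRank_nonneg _ _))

theorem fanoDefect_nonneg (a b c p q r s : X) : 0 ≤ fanoDefect a b c p q r s h :=
  add_nonneg (H.configDefect_nonneg _ _ _ _ _ _ _) (add_nonneg (add_nonneg (add_nonneg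
    (H.condRank_nonneg _ _) (H.mutualRank_nonneg _ _)) (H.mutualRank_nonneg _ _))
      (H.mutualRank_nonneg _ _))

theorem nonFanoDefect_nonneg (a b c p q r s : X) : 0 ≤ nonFanoDefect a b c p q r s h :=
  add_nonneg (H.configDefect_nonneg _ _ _ _ _ _ _) (add_nonneg (add_nonneg
    (H.mutualRank_nonneg _ _) (H.mutualRank_nonneg _ _)) (H.mutualRank_nonneg _ _))

theorem triple_le_three_mul {a b c r : X} {δ : ℝ}
    (hδ : h {a} + h {b} + h {c} ≤ δ + condRank {a, b, c} {r} h) :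
    h {a, b, c} ≤ 3 * (δ +
      (condRank {a} {b, c, r} h + condRank {b} {a, c, r} h + condRank {c} {a, b, r} h)) := by
  have hchain (x y z : X) :
      condRank {x, y, z} {r} h ≤ condRank {x} {y, z, r} h + h {y} + h {z} := by
    simp only [condRank_apply, Finset.insert_union, Finset.singleton_union]
    linarith [H.insert_le y {z, r}, H.insert_le z {r}]
  have hb := hchain b a c
  have hc := hchain c a b
  rw [Finset.insert_comm b a] at hb
  rw [Finset.insert_comm c a, Finset.pair_comm c b] at hc
  linarith [hchain a b c, H.insert_le a {b, c}, H.insert_le b {c},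
    H.condRank_nonneg {a} {b, c, r}, H.condRank_nonneg {b} {a, c, r},
    H.condRank_nonneg {c} {a, b, r}]

end IsPolymatroid

end Defects

section RankInequalities

variable {F W X : Type*} [Field F] [AddCommGroup W] [Module F W] [DecidableEq X]
  (V : X → Submodule F W)

theorem condRank_subspaceRank (A B : Finset X) :
    condRank A B (subspaceRank F V) = condDim (A.sup V) (B.sup V) := by
  rw [condRank_apply, subspaceRank_eq, subspaceRank_eq, Finset.sup_union, condDim]

variable [∀ i, FiniteDimensional F (V i)]

theorem mutualRank_subspaceRank (A B : Finset X) :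
    mutualRank A B (subspaceRank F V) = dim (A.sup V ⊓ B.sup V) := by
  rw [mutualRank_apply, subspaceRank_eq, subspaceRank_eq, subspaceRank_eq, Finset.sup_union]
  linarith [dim_sup_add_dim_inf (A.sup V) (B.sup V)]

theorem subspaceRank_triple_le {a b c p q r s : X} {δ : ℝ}
    (hδ : ∀ {x y z : V a × V b × V c →ₗ[F] W}, (∀ w, x w ∈ V a) → (∀ w, y w ∈ V b) →
      (∀ w, z w ∈ V c) → LinearMap.ker x ⊓ LinearMap.ker y ⊓ LinearMap.ker z = ⊥ →
      dim (sumSpace x y z (V p) (V q) (V r) (V s)) ≤ δ) :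
    subspaceRank F V {a, b, c} ≤ 3 * (configDefect a b c p q r s (subspaceRank F V) + δ) := by
  let x := (V a).subtype ∘ₗ LinearMap.fst F (V a) (V b × V c)
  let y := (V b).subtype ∘ₗ LinearMap.fst F (V b) (V c) ∘ₗ LinearMap.snd F (V a) (V b × V c)
  let z := (V c).subtype ∘ₗ LinearMap.snd F (V b) (V c) ∘ₗ LinearMap.snd F (V a) (V b × V c)
  have hx (w) : x w ∈ V a := w.1.2
  have hy (w) : y w ∈ V b := w.2.1.2
  have hz (w) : z w ∈ V c := w.2.2.2
  have hinj : LinearMap.ker x ⊓ LinearMap.ker y ⊓ LinearMap.ker z = ⊥ := by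
    rw [eq_bot_iff]
    rintro w ⟨⟨hwx, hwy⟩, hwz⟩
    exact Prod.ext (Subtype.ext hwx) (Prod.ext (Subtype.ext hwy) (Subtype.ext hwz))
  have hupper := hδ hx hy hz hinj
  have hlower := finrank_le_dim_sumSpace_add (P := V p) (Q := V q) (R := V r) (S := V s) hx hy hz
  have hfinrank :
      (Module.finrank F (V a × V b × V c) : ℝ) = dim (V a) + dim (V b) + dim (V c) := by
    simp only [Module.finrank_prod, dim, Nat.cast_add, add_assoc]
  refine ((isPolymatroid_subspaceRank V).triple_le_three_mul (a := a) (b := b) (c := c) (r := r)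
    (δ := δ + sumDefect a b c p r (subspaceRank F V) + sumDefect b c a q r (subspaceRank F V) +
      sumDefect a c b s r (subspaceRank F V)) ?_).trans_eq ?_
  · simp only [sumDefect, LinearMap.add_apply, condRank_subspaceRank, mutualRank_subspaceRank,
      Finset.sup_insert, Finset.sup_singleton, subspaceRank_eq, ← sup_assoc]
    linarith
  · simp only [configDefect, LinearMap.add_apply]
    ring

theorem subspaceRank_triple_le_fanoDefect (h2 : (2 : F) ≠ 0) (a b c p q r s : X) :
    subspaceRank F V {a, b, c} ≤ 3 * fanoDefect a b c p q r s (subspaceRank F V) := by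
  refine subspaceRank_triple_le V fun hx hy hz hinj => ?_
  simpa only [LinearMap.add_apply, condRank_subspaceRank, mutualRank_subspaceRank,
    Finset.sup_insert, Finset.sup_singleton] using
    dim_sumSpace_le_of_two_ne_zero h2 hx hy hz hinj

theorem subspaceRank_triple_le_nonFanoDefect (h2 : (2 : F) = 0) (a b c p q r s : X) :
    subspaceRank F V {a, b, c} ≤ 3 * nonFanoDefect a b c p q r s (subspaceRank F V) := by
  refine subspaceRank_triple_le V fun hx hy hz hinj => ?_
  simpa only [LinearMap.add_apply, mutualRank_subspaceRank, Finset.sup_insert,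
    Finset.sup_singleton] using dim_sumSpace_le_of_two_eq_zero h2 hx hy hz hinj

end RankInequalities

section LineConfigurations

variable {F W X : Type*} [Field F] [AddCommGroup W] [Module F W] {v : X → W}

/-- The rank function of the lines spanned by the vectors `v i`. -/
abbrev lineRank (F : Type*) {W X : Type*} [Field F] [AddCommGroup W] [Module F W] (v : X → W) :
    RankFun X :=
  subspaceRank F fun i => Submodule.span F {v i}

theorem sup_span_singleton (v : X → W) (A : Finset X) :
    (A.sup fun i => Submodule.span F {v i}) = Submodule.span F (v '' A) := by
  simp only [Finset.sup_eq_iSup, Set.image_eq_iUnion, Submodule.span_iUnion, Finset.mem_coe]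

/-- The seven vectors of the Fano matroid, over a field of any characteristic. -/
structure IsSumConfig (F : Type*) {W X : Type*} [Field F] [AddCommGroup W] [Module F W]
    (v : X → W) (a b c p q r s : X) : Prop where
  linearIndependent : LinearIndependent F ![v a, v b, v c]
  p_eq : v p = v a + v b
  q_eq : v q = v b + v c
  r_eq : v r = v a + v b + v c
  s_eq : v s = v a + v c

variable [DecidableEq X]

theorem condRank_lineRank_eq_zero {A B : Finset X}
    (h : ∀ x ∈ A, v x ∈ Submodule.span F (v '' B)) : condRank A B (lineRank F v) = 0 := by
  have hle : Submodule.span F (v '' A) ≤ Submodule.span F (v '' B) :=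
    Submodule.span_le.2 (Set.forall_mem_image.2 h)
  rw [condRank_subspaceRank, sup_span_singleton, sup_span_singleton, condDim,
    sup_eq_right.2 hle, sub_self]

theorem condRank_pair_lineRank_eq_zero {x y z : X} (h : v x ∈ Submodule.span F {v y, v z}) :
    condRank {x} {y, z} (lineRank F v) = 0 :=
  condRank_lineRank_eq_zero (by simpa [Set.image_insert_eq] using h)

theorem condRank_triple_lineRank_eq_zero {x y z w : X}
    (h : v x ∈ Submodule.span F {v y, v z, v w}) :
    condRank {x} {y, z, w} (lineRank F v) = 0 :=
  condRank_lineRank_eq_zero (by simpa [Set.image_insert_eq] using h)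

theorem mutualRank_lineRank_eq_zero {x : X} {A : Finset X}
    (h : v x ∉ Submodule.span F (v '' A)) : mutualRank {x} A (lineRank F v) = 0 := by
  have hdisj := (Submodule.disjoint_span_singleton_of_notMem h).symm
  rw [mutualRank_subspaceRank, Finset.sup_singleton, sup_span_singleton, hdisj.eq_bot, dim_bot]

theorem mutualRank_singleton_lineRank_eq_zero {x y : X} (h : v x ∉ Submodule.span F {v y}) :
    mutualRank {x} {y} (lineRank F v) = 0 :=
  mutualRank_lineRank_eq_zero (by simpa using h)

theorem mutualRank_pair_lineRank_eq_zero {x y z : X} (h : v x ∉ Submodule.span F {v y, v z}) :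
    mutualRank {x} {y, z} (lineRank F v) = 0 :=
  mutualRank_lineRank_eq_zero (by simpa [Set.image_insert_eq] using h)

theorem sumDefect_lineRank_eq_zero {a b c p r : X} (hp : v p = v a + v b)
    (hr : v r = v c + v p) (hc : v c ∉ Submodule.span F {v a, v b}) :
    sumDefect a b c p r (lineRank F v) = 0 := by
  have hrcp : condRank {r} {c, p} (lineRank F v) = 0 :=
    condRank_pair_lineRank_eq_zero (Submodule.mem_span_pair.2 ⟨1, 1, by simp [hr]⟩)
  have hpab : condRank {p} {a, b} (lineRank F v) = 0 :=
    condRank_pair_lineRank_eq_zero (Submodule.mem_span_pair.2 ⟨1, 1, by simp [hp]⟩)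
  simp only [sumDefect, LinearMap.add_apply, hrcp, hpab, mutualRank_pair_lineRank_eq_zero hc,
    add_zero]

namespace IsSumConfig

variable {a b c p q r s : X} (H : IsSumConfig F v a b c p q r s)

include H

omit [DecidableEq X] in
theorem eq_zero_of_smul_add_smul_add_smul_eq_zero {α β γ : F}
    (h : α • v a + β • v b + γ • v c = 0) : α = 0 ∧ β = 0 ∧ γ = 0 := by
  have hcoeff := Fintype.linearIndependent_iff.1 H.linearIndependent ![α, β, γ]
    (by simpa [Fin.sum_univ_three] using h)
  exact ⟨hcoeff 0, hcoeff 1, hcoeff 2⟩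

theorem sumDefects_eq_zero : sumDefect a b c p r (lineRank F v) = 0 ∧
    sumDefect b c a q r (lineRank F v) = 0 ∧ sumDefect a c b s r (lineRank F v) = 0 := by
  refine ⟨sumDefect_lineRank_eq_zero H.p_eq ?_ ?_, sumDefect_lineRank_eq_zero H.q_eq ?_ ?_,
    sumDefect_lineRank_eq_zero H.s_eq ?_ ?_⟩
  · rw [H.r_eq, H.p_eq, add_comm]
  · intro hc
    obtain ⟨α, β, h⟩ := Submodule.mem_span_pair.1 hc
    simpa using H.eq_zero_of_smul_add_smul_add_smul_eq_zero (α := α) (β := β) (γ := -1)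
      (by linear_combination (norm := module) h)
  · rw [H.r_eq, H.q_eq, add_assoc]
  · intro ha
    obtain ⟨β, γ, h⟩ := Submodule.mem_span_pair.1 ha
    simpa using H.eq_zero_of_smul_add_smul_add_smul_eq_zero (α := -1) (β := β) (γ := γ)
      (by linear_combination (norm := module) h)
  · rw [H.r_eq, H.s_eq]
    abel
  · intro hb
    obtain ⟨α, γ, h⟩ := Submodule.mem_span_pair.1 hb
    simpa using H.eq_zero_of_smul_add_smul_add_smul_eq_zero (α := α) (β := -1) (γ := γ)
      (by linear_combination (norm := module) h)

theorem configDefect_eq_zero : configDefect a b c p q r s (lineRank F v) = 0 := by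
  obtain ⟨hp, hq, hs⟩ := H.sumDefects_eq_zero
  have ha : condRank {a} {b, c, r} (lineRank F v) = 0 :=
    condRank_triple_lineRank_eq_zero (Submodule.mem_span_triple.2 ⟨-1, -1, 1, by
      rw [H.r_eq]
      module⟩)
  have hb : condRank {b} {a, c, r} (lineRank F v) = 0 :=
    condRank_triple_lineRank_eq_zero (Submodule.mem_span_triple.2 ⟨-1, -1, 1, by
      rw [H.r_eq]
      module⟩)
  have hc : condRank {c} {a, b, r} (lineRank F v) = 0 :=
    condRank_triple_lineRank_eq_zero (Submodule.mem_span_triple.2 ⟨-1, -1, 1, by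
      rw [H.r_eq]
      module⟩)
  simp only [configDefect, LinearMap.add_apply, hp, hq, hs, ha, hb, hc, add_zero]

theorem fanoDefect_eq_zero (h2 : (2 : F) = 0) :
    fanoDefect a b c p q r s (lineRank F v) = 0 := by
  have hp : v p ∈ Submodule.span F {v q, v s} := by
    have h2c : (2 : F) • v c = 0 := by rw [h2, zero_smul]
    refine Submodule.mem_span_pair.2 ⟨1, 1, ?_⟩
    rw [H.p_eq, H.q_eq, H.s_eq]
    linear_combination (norm := module) h2c
  have hc : v c ∉ Submodule.span F {v q, v s} := by
    intro hc
    obtain ⟨β, α, h⟩ := Submodule.mem_span_pair.1 hc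
    rw [H.q_eq, H.s_eq] at h
    obtain ⟨hα, hβ, hαβ⟩ := H.eq_zero_of_smul_add_smul_add_smul_eq_zero
      (α := α) (β := β) (γ := α + β - 1) (by linear_combination (norm := module) h)
    simp [hα, hβ] at hαβ
  have hb : v b ∉ Submodule.span F {v q} := by
    intro hb
    obtain ⟨β, h⟩ := Submodule.mem_span_singleton.1 hb
    rw [H.q_eq] at h
    obtain ⟨-, hβ, hγ⟩ := H.eq_zero_of_smul_add_smul_add_smul_eq_zero
      (α := 0) (β := β - 1) (γ := β) (by linear_combination (norm := module) h)
    simp [hγ] at hβ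
  have ha : v a ∉ Submodule.span F {v s} := by
    intro ha
    obtain ⟨α, h⟩ := Submodule.mem_span_singleton.1 ha
    rw [H.s_eq] at h
    obtain ⟨hα, -, hγ⟩ := H.eq_zero_of_smul_add_smul_add_smul_eq_zero
      (α := α - 1) (β := 0) (γ := α) (by linear_combination (norm := module) h)
    simp [hγ] at hα
  simp only [fanoDefect, LinearMap.add_apply, H.configDefect_eq_zero,
    condRank_pair_lineRank_eq_zero hp, mutualRank_pair_lineRank_eq_zero hc,
    mutualRank_singleton_lineRank_eq_zero hb, mutualRank_singleton_lineRank_eq_zero ha, add_zero]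

theorem nonFanoDefect_eq_zero (h2 : (2 : F) ≠ 0) :
    nonFanoDefect a b c p q r s (lineRank F v) = 0 := by
  have hp : v p ∉ Submodule.span F {v q, v s} := by
    intro hp
    obtain ⟨β, α, h⟩ := Submodule.mem_span_pair.1 hp
    rw [H.p_eq, H.q_eq, H.s_eq] at h
    obtain ⟨hα, hβ, hαβ⟩ := H.eq_zero_of_smul_add_smul_add_smul_eq_zero
      (α := α - 1) (β := β - 1) (γ := α + β) (by linear_combination (norm := module) h)
    exact h2 (by linear_combination hαβ - hα - hβ)
  have hr : v r ∉ Submodule.span F {v c} := by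
    intro hr
    obtain ⟨γ, h⟩ := Submodule.mem_span_singleton.1 hr
    rw [H.r_eq] at h
    simpa using H.eq_zero_of_smul_add_smul_add_smul_eq_zero (α := -1) (β := -1) (γ := γ - 1)
      (by linear_combination (norm := module) h)
  have ha : v a ∉ Submodule.span F {v b} := by
    intro ha
    obtain ⟨β, h⟩ := Submodule.mem_span_singleton.1 ha
    simpa using H.eq_zero_of_smul_add_smul_add_smul_eq_zero (α := -1) (β := β) (γ := 0)
      (by linear_combination (norm := module) h)
  simp only [nonFanoDefect, LinearMap.add_apply, H.configDefect_eq_zero,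
    mutualRank_pair_lineRank_eq_zero hp, mutualRank_singleton_lineRank_eq_zero hr,
    mutualRank_singleton_lineRank_eq_zero ha, add_zero]

end IsSumConfig

end LineConfigurations

section Separation

variable {X : Type*} [Fintype X]

theorem exists_linearForm_eq (L : RankFun X →ₗ[ℝ] ℝ) :
    ∃ c : Finset X → ℝ, ∀ h, linearForm c h = L h := by
  classical
  refine ⟨fun A => L fun B => if A = B then 1 else 0, fun h => ?_⟩
  rw [LinearMap.pi_apply_eq_sum_univ L h]
  exact Finset.sum_congr rfl fun A _ => mul_comm _ _

theorem IsCCRepresentable.linearForm_nonneg {c : Finset X → ℝ} (hc : IsSubspaceRankInequality c)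
    {h : RankFun X} (hh : IsCCRepresentable h) : 0 ≤ linearForm c h := by
  let L := Fintype.linearCombination ℝ c
  have hL (g) : L g = linearForm c g := by
    simp only [L, Fintype.linearCombination_apply, linearForm, smul_eq_mul, mul_comm]
  have hhull : ConvexCone.hull ℝ {g | IsRepresentable g} ≤ (ConvexCone.positive ℝ ℝ).comap L :=
    ConvexCone.hull_min fun g hg => (hc g hg).trans_eq (hL g).symm
  have hclosed : IsClosed ((ConvexCone.positive ℝ ℝ).comap L : Set (RankFun X)) :=
    isClosed_Ici.preimage L.continuous_of_finiteDimensional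
  exact (closure_minimal hhull hclosed hh : 0 ≤ L h).trans_eq (hL h)

theorem not_isCCRepresentable_of_linearForm_neg {c : Finset X → ℝ}
    (hc : IsSubspaceRankInequality c) {h : RankFun X} (hneg : linearForm c h < 0) :
    ¬ IsCCRepresentable h :=
  fun hh => hneg.not_ge (hh.linearForm_nonneg hc)

end Separation

section Restriction

variable {X Y : Type*}

/-- Restriction of rank functions along an embedding of ground sets, as a linear map. -/
def restrict (f : Y ↪ X) : RankFun X →ₗ[ℝ] RankFun Y :=
  LinearMap.funLeft ℝ ℝ (Finset.map f)

theorem restrict_apply (f : Y ↪ X) (h : RankFun X) (A : Finset Y) :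
    restrict f h A = h (A.map f) := rfl

theorem restrict_subspaceRank {F W : Type*} [Field F] [AddCommGroup W] [Module F W] (f : Y ↪ X)
    (V : X → Submodule F W) : restrict f (subspaceRank F V) =
      subspaceRank F fun i => V (f i) := by
  ext A
  rw [restrict_apply, subspaceRank_eq, subspaceRank_eq, Finset.sup_map]
  rfl

theorem IsPolymatroid.restrict_univ_le [Fintype X] [Fintype Y] [DecidableEq X] {h : RankFun X}
    (H : IsPolymatroid h) (f : Y ↪ X) : restrict f h Finset.univ ≤ h Finset.univ :=
  H.mono _ _ (Finset.subset_univ _)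

end Restriction

section Gluing

open Function (Embedding)

variable {X₁ X₂ : Type*} [Fintype X₁] [Fintype X₂]

theorem directSum_univ (h₁ : RankFun X₁) (h₂ : RankFun X₂) :
    directSum h₁ h₂ Finset.univ = h₁ Finset.univ + h₂ Finset.univ := by
  have hleft : (Finset.univ : Finset (X₁ ⊕ X₂)).toLeft = Finset.univ := by ext; simp
  have hright : (Finset.univ : Finset (X₁ ⊕ X₂)).toRight = Finset.univ := by ext; simp
  rw [directSum, hleft, hright]

/-- Combines rank inequalities `h X₁ ≤ S₁ h` and `h X₂ ≤ S₂ h`, each valid over some fields only,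
into a linear form on rank functions of `X₁ ⊕ X₂` that is nonnegative over all these fields. -/
def gluedForm (S₁ : RankFun X₁ →ₗ[ℝ] ℝ) (S₂ : RankFun X₂ →ₗ[ℝ] ℝ) : RankFun (X₁ ⊕ X₂) →ₗ[ℝ] ℝ :=
  rankAt Finset.univ + (S₁ - rankAt Finset.univ) ∘ₗ restrict Embedding.inl +
    (S₂ - rankAt Finset.univ) ∘ₗ restrict Embedding.inr

theorem gluedForm_apply (S₁ : RankFun X₁ →ₗ[ℝ] ℝ) (S₂ : RankFun X₂ →ₗ[ℝ] ℝ)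
    (h : RankFun (X₁ ⊕ X₂)) : gluedForm S₁ S₂ h = h Finset.univ +
      (S₁ (restrict Embedding.inl h) - restrict Embedding.inl h Finset.univ) +
      (S₂ (restrict Embedding.inr h) - restrict Embedding.inr h Finset.univ) := rfl

variable {S₁ : RankFun X₁ →ₗ[ℝ] ℝ} {S₂ : RankFun X₂ →ₗ[ℝ] ℝ} [DecidableEq X₁] [DecidableEq X₂]

theorem IsPolymatroid.gluedForm_nonneg_of_left {h : RankFun (X₁ ⊕ X₂)} (H : IsPolymatroid h)
    (h₁ : restrict Embedding.inl h Finset.univ ≤ S₁ (restrict Embedding.inl h))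
    (h₂ : 0 ≤ S₂ (restrict Embedding.inr h)) : 0 ≤ gluedForm S₁ S₂ h := by
  rw [gluedForm_apply]
  linarith [H.restrict_univ_le Embedding.inr]

theorem IsPolymatroid.gluedForm_nonneg_of_right {h : RankFun (X₁ ⊕ X₂)} (H : IsPolymatroid h)
    (h₁ : 0 ≤ S₁ (restrict Embedding.inl h))
    (h₂ : restrict Embedding.inr h Finset.univ ≤ S₂ (restrict Embedding.inr h)) :
    0 ≤ gluedForm S₁ S₂ h := by
  rw [gluedForm_apply]
  linarith [H.restrict_univ_le Embedding.inl]

variable {h₁ : RankFun X₁} {h₂ : RankFun X₂} {ε : ℝ}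

theorem restrict_inl_perturb_directSum (H₁ : IsPolymatroid h₁) (H₂ : IsPolymatroid h₂)
    (hε : ε ≤ h₂ Finset.univ) :
    restrict Embedding.inl (perturb ε (directSum h₁ h₂)) = h₁ := by
  ext A
  have hleft : (A.map (Embedding.inl : X₁ ↪ X₁ ⊕ X₂)).toLeft = A := by ext; simp
  have hright : (A.map (Embedding.inl : X₁ ↪ X₁ ⊕ X₂)).toRight = ∅ := by ext; simp
  rw [restrict_apply, perturb, directSum_univ, directSum, hleft, hright, H₂.empty, add_zero]
  exact min_eq_left (by linarith [H₁.mono A Finset.univ (Finset.subset_univ A)])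

theorem restrict_inr_perturb_directSum (H₁ : IsPolymatroid h₁) (H₂ : IsPolymatroid h₂)
    (hε : ε ≤ h₁ Finset.univ) :
    restrict Embedding.inr (perturb ε (directSum h₁ h₂)) = h₂ := by
  ext A
  have hleft : (A.map (Embedding.inr : X₂ ↪ X₁ ⊕ X₂)).toLeft = ∅ := by ext; simp
  have hright : (A.map (Embedding.inr : X₂ ↪ X₁ ⊕ X₂)).toRight = A := by ext; simp
  rw [restrict_apply, perturb, directSum_univ, directSum, hleft, hright, H₁.empty, zero_add]
  exact min_eq_left (by linarith [H₂.mono A Finset.univ (Finset.subset_univ A)])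

theorem gluedForm_perturb_directSum_le (S₁ : RankFun X₁ →ₗ[ℝ] ℝ) (S₂ : RankFun X₂ →ₗ[ℝ] ℝ)
    (H₁ : IsPolymatroid h₁) (H₂ : IsPolymatroid h₂) (hε₁ : ε ≤ h₁ Finset.univ)
    (hε₂ : ε ≤ h₂ Finset.univ) :
    gluedForm S₁ S₂ (perturb ε (directSum h₁ h₂)) ≤ S₁ h₁ + S₂ h₂ - ε := by
  have huniv : perturb ε (directSum h₁ h₂) Finset.univ ≤ h₁ Finset.univ + h₂ Finset.univ - ε := by
    rw [← directSum_univ]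
    exact min_le_right _ _
  rw [gluedForm_apply, restrict_inl_perturb_directSum H₁ H₂ hε₂,
    restrict_inr_perturb_directSum H₁ H₂ hε₁]
  linarith

end Gluing

section Witness

/-- The linear form of an inequality `h X₁ ≤ defect₁ h` that is valid over fields of
characteristic other than two and fails for the Fano matroid. -/
def defect₁ : RankFun Ground₁ →ₗ[ℝ] ℝ :=
  (3 : ℝ) • fanoDefect (.inl 0) (.inl 1) (.inl 2) (.inr 0) (.inr 1) (.inr 2) (.inr 3) +
    condRank Finset.univ {.inl 0, .inl 1, .inl 2}

/-- The linear form of an inequality `h X₂ ≤ defect₂ h` that is valid over fields of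
characteristic two and fails for the second Dougherty-Freiling-Zeger matroid, which consists of
two non-Fano configurations sharing the line spanned by `v₃`. -/
def defect₂ : RankFun Ground₂ →ₗ[ℝ] ℝ :=
  (3 : ℝ) • nonFanoDefect (.inl 0) (.inl 1) (.inl 2) (.inr 2) (.inr 4) (.inr 0) (.inr 3) +
    (3 : ℝ) • nonFanoDefect (.inl 2) (.inl 3) (.inl 4) (.inr 5) (.inr 7) (.inr 1) (.inr 6) +
    condRank Finset.univ ({.inl 0, .inl 1, .inl 2} ∪ {.inl 2, .inl 3, .inl 4})

theorem IsPolymatroid.defect₁_nonneg {h : RankFun Ground₁} (H : IsPolymatroid h) :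
    0 ≤ defect₁ h :=
  add_nonneg (mul_nonneg zero_le_three (H.fanoDefect_nonneg _ _ _ _ _ _ _))
    (H.condRank_nonneg _ _)

theorem IsPolymatroid.defect₂_nonneg {h : RankFun Ground₂} (H : IsPolymatroid h) :
    0 ≤ defect₂ h :=
  add_nonneg (add_nonneg (mul_nonneg zero_le_three (H.nonFanoDefect_nonneg _ _ _ _ _ _ _))
    (mul_nonneg zero_le_three (H.nonFanoDefect_nonneg _ _ _ _ _ _ _))) (H.condRank_nonneg _ _)

variable {F W : Type*} [Field F] [AddCommGroup W] [Module F W]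

theorem subspaceRank_univ_le_defect₁ (h2 : (2 : F) ≠ 0) (V : Ground₁ → Submodule F W)
    [∀ i, FiniteDimensional F (V i)] :
    subspaceRank F V Finset.univ ≤ defect₁ (subspaceRank F V) := by
  simp only [defect₁, LinearMap.add_apply, LinearMap.smul_apply, smul_eq_mul, condRank_apply,
    Finset.union_eq_left.2 (Finset.subset_univ _)]
  linarith [subspaceRank_triple_le_fanoDefect V h2 (.inl 0) (.inl 1) (.inl 2) (.inr 0) (.inr 1)
    (.inr 2) (.inr 3)]

theorem subspaceRank_univ_le_defect₂ (h2 : (2 : F) = 0) (V : Ground₂ → Submodule F W)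
    [∀ i, FiniteDimensional F (V i)] :
    subspaceRank F V Finset.univ ≤ defect₂ (subspaceRank F V) := by
  simp only [defect₂, LinearMap.add_apply, LinearMap.smul_apply, smul_eq_mul, condRank_apply,
    Finset.union_eq_left.2 (Finset.subset_univ _)]
  linarith [(isPolymatroid_subspaceRank V).union_le {.inl 0, .inl 1, .inl 2}
      {.inl 2, .inl 3, .inl 4},
    subspaceRank_triple_le_nonFanoDefect V h2 (.inl 0) (.inl 1) (.inl 2) (.inr 2) (.inr 4)
      (.inr 0) (.inr 3),
    subspaceRank_triple_le_nonFanoDefect V h2 (.inl 2) (.inl 3) (.inl 4) (.inr 5) (.inr 7)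
      (.inr 1) (.inr 6)]

theorem gluedForm_defect_subspaceRank_nonneg (V : Ground₁ ⊕ Ground₂ → Submodule F W)
    [∀ i, FiniteDimensional F (V i)] : 0 ≤ gluedForm defect₁ defect₂ (subspaceRank F V) := by
  have H := isPolymatroid_subspaceRank V
  by_cases h2 : (2 : F) = 0
  · refine H.gluedForm_nonneg_of_right ?_ ?_ <;> rw [restrict_subspaceRank]
    · exact (isPolymatroid_subspaceRank _).defect₁_nonneg
    · exact subspaceRank_univ_le_defect₂ h2 _
  · refine H.gluedForm_nonneg_of_left ?_ ?_ <;> rw [restrict_subspaceRank]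
    · exact subspaceRank_univ_le_defect₁ h2 _
    · exact (isPolymatroid_subspaceRank _).defect₂_nonneg

theorem vectors₁_mem {u : Fin 3 → W} {M : Submodule F W} (hu : ∀ i, u i ∈ M) (x : Ground₁) :
    vectors₁ u x ∈ M := by
  rcases x with i | i
  · exact hu i
  · fin_cases i <;> simp [vectors₁, hu, add_mem]

theorem vectors₂_mem {u : Fin 5 → W} {M : Submodule F W} (hu : ∀ i, u i ∈ M) (x : Ground₂) :
    vectors₂ u x ∈ M := by
  rcases x with i | i
  · exact hu i
  · fin_cases i <;> simp [vectors₂, hu, add_mem]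

theorem defect₁_Φ₁ {u : Fin 3 → W} (hu : LinearIndependent F u) (h2 : (2 : F) = 0) :
    defect₁ (Φ₁ F u) = 0 := by
  have hconfig : IsSumConfig F (vectors₁ u) (.inl 0) (.inl 1) (.inl 2) (.inr 0) (.inr 1) (.inr 2)
      (.inr 3) := by
    refine ⟨?_, rfl, rfl, rfl, rfl⟩
    convert hu using 1
    ext i
    fin_cases i <;> rfl
  have hspan : condRank Finset.univ {.inl 0, .inl 1, .inl 2} (lineRank F (vectors₁ u)) = 0 := by
    refine condRank_lineRank_eq_zero fun x _ => vectors₁_mem (fun i => ?_) x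
    exact Submodule.mem_span_of_mem ⟨.inl i, by fin_cases i <;> simp, rfl⟩
  change defect₁ (lineRank F (vectors₁ u)) = 0
  simp only [defect₁, LinearMap.add_apply, LinearMap.smul_apply, hconfig.fanoDefect_eq_zero h2,
    hspan, smul_zero, add_zero]

theorem defect₂_Φ₂ {u : Fin 5 → W} (hu : LinearIndependent F u) (h2 : (2 : F) ≠ 0) :
    defect₂ (Φ₂ F u) = 0 := by
  have hfirst : IsSumConfig F (vectors₂ u) (.inl 0) (.inl 1) (.inl 2) (.inr 2) (.inr 4) (.inr 0)
      (.inr 3) := by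
    refine ⟨?_, rfl, rfl, rfl, rfl⟩
    convert hu.comp ![0, 1, 2] (by decide) using 1
    ext i
    fin_cases i <;> rfl
  have hsecond : IsSumConfig F (vectors₂ u) (.inl 2) (.inl 3) (.inl 4) (.inr 5) (.inr 7) (.inr 1)
      (.inr 6) := by
    refine ⟨?_, rfl, rfl, rfl, rfl⟩
    convert hu.comp ![2, 3, 4] (by decide) using 1
    ext i
    fin_cases i <;> rfl
  have hspan : condRank Finset.univ ({.inl 0, .inl 1, .inl 2} ∪ {.inl 2, .inl 3, .inl 4})
      (lineRank F (vectors₂ u)) = 0 := by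
    refine condRank_lineRank_eq_zero fun x _ => vectors₂_mem (fun i => ?_) x
    exact Submodule.mem_span_of_mem ⟨.inl i, by fin_cases i <;> simp, rfl⟩
  change defect₂ (lineRank F (vectors₂ u)) = 0
  simp only [defect₂, LinearMap.add_apply, LinearMap.smul_apply, hfirst.nonFanoDefect_eq_zero h2,
    hsecond.nonFanoDefect_eq_zero h2, hspan, smul_zero, add_zero]

theorem lineRank_univ_pos {X : Type*} [Fintype X] {v : X → W} {x : X} (hx : v x ≠ 0) :
    0 < lineRank F v Finset.univ := by
  classical
  have hpos : 0 < lineRank F v {x} := by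
    rw [lineRank, subspaceRank_eq, Finset.sup_singleton, dim, finrank_span_singleton hx,
      Nat.cast_one]
    exact one_pos
  exact hpos.trans_le ((isPolymatroid_subspaceRank _).mono _ _ (Finset.subset_univ _))

variable {F₁ W₁ F₂ W₂ : Type*} [Field F₁] [AddCommGroup W₁] [Module F₁ W₁] [Field F₂]
  [AddCommGroup W₂] [Module F₂ W₂] {u : Fin 3 → W₁} {v : Fin 5 → W₂} {ε : ℝ}

theorem isIngletonian_perturb_directSum_Φ
    (hε : ε ≤ min (Φ₁ F₁ u Finset.univ) (Φ₂ F₂ v Finset.univ)) :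
    IsIngletonian (perturb ε (directSum (Φ₁ F₁ u) (Φ₂ F₂ v))) := by
  have H₁ : IsIngletonian (Φ₁ F₁ u) := isIngletonian_subspaceRank _
  have H₂ : IsIngletonian (Φ₂ F₂ v) := isIngletonian_subspaceRank _
  refine (H₁.directSum H₂).perturb ?_
  rw [directSum_univ]
  linarith [(le_min_iff.1 hε).1, H₂.isPolymatroid.nonneg Finset.univ]

theorem exists_isSubspaceRankInequality_linearForm_neg (hF₁ : (2 : F₁) = 0) (hF₂ : (2 : F₂) ≠ 0)
    (hu : LinearIndependent F₁ u) (hv : LinearIndependent F₂ v) (hε : 0 < ε)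
    (hε' : ε ≤ min (Φ₁ F₁ u Finset.univ) (Φ₂ F₂ v Finset.univ)) :
    ∃ c : Finset (Ground₁ ⊕ Ground₂) → ℝ, IsSubspaceRankInequality c ∧
      linearForm c (perturb ε (directSum (Φ₁ F₁ u) (Φ₂ F₂ v))) < 0 := by
  obtain ⟨c, hc⟩ := exists_linearForm_eq (gluedForm defect₁ defect₂)
  obtain ⟨hε₁, hε₂⟩ := le_min_iff.1 hε'
  refine ⟨c, ?_, ?_⟩
  · rintro h ⟨_, F, _, _, W, _, _, _, V, -, rfl⟩
    rw [hc]
    exact gluedForm_defect_subspaceRank_nonneg V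
  · have hle := gluedForm_perturb_directSum_le defect₁ defect₂
      (isPolymatroid_subspaceRank _) (isPolymatroid_subspaceRank _) hε₁ hε₂
    rw [← Φ₁, ← Φ₂, defect₁_Φ₁ hu hF₁, defect₂_Φ₂ hv hF₂] at hle
    rw [hc]
    linarith

theorem exists_isIngletonian_linearForm_neg :
    ∃ (h : RankFun (Ground₁ ⊕ Ground₂)) (c : Finset (Ground₁ ⊕ Ground₂) → ℝ),
      IsIngletonian h ∧ IsSubspaceRankInequality c ∧ linearForm c h < 0 := by
  have hu := (Pi.basisFun (ZMod 2) (Fin 3)).linearIndependent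
  have hv := (Pi.basisFun (ZMod 3) (Fin 5)).linearIndependent
  have hε : 0 < min (Φ₁ (ZMod 2) (Pi.basisFun (ZMod 2) (Fin 3)) Finset.univ)
      (Φ₂ (ZMod 3) (Pi.basisFun (ZMod 3) (Fin 5)) Finset.univ) :=
    lt_min (lineRank_univ_pos (v := vectors₁ _) (x := .inl 0) (hu.ne_zero 0))
      (lineRank_univ_pos (v := vectors₂ _) (x := .inl 0) (hv.ne_zero 0))
  obtain ⟨c, hc, hneg⟩ :=
    exists_isSubspaceRankInequality_linearForm_neg (by decide) (by decide) hu hv hε le_rfl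
  exact ⟨_, c, isIngletonian_perturb_directSum_Φ le_rfl, hc, hneg⟩

end Witness

end Polymat

end

theorem mainTheorem1_general :
    (∃ (X : Type) (_ : Fintype X) (_ : DecidableEq X) (h : Polymat.RankFun X),
      Polymat.IsIngletonian h ∧ ¬ Polymat.IsCCRepresentable h) ∧
    (∃ (X : Type) (_ : Fintype X) (_ : DecidableEq X) (c : Finset X → ℝ),
      Polymat.IsSubspaceRankInequality c ∧ ¬ Polymat.IsImpliedByIngleton c) ∧
    (∀ (F₁ W₁ F₂ W₂ : Type*) [Field F₁] [AddCommGroup W₁] [Module F₁ W₁]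
      [Field F₂] [AddCommGroup W₂] [Module F₂ W₂]
      (u : Fin 3 → W₁) (v : Fin 5 → W₂) (ε : ℝ),
      (2 : F₁) = 0 → (2 : F₂) ≠ 0 →
      LinearIndependent F₁ u → LinearIndependent F₂ v →
      0 < ε → ε ≤ min (Polymat.Φ₁ F₁ u Finset.univ) (Polymat.Φ₂ F₂ v Finset.univ) →
      Polymat.IsIngletonian
          (Polymat.perturb ε (Polymat.directSum (Polymat.Φ₁ F₁ u) (Polymat.Φ₂ F₂ v))) ∧
        ¬ Polymat.IsCCRepresentable
          (Polymat.perturb ε (Polymat.directSum (Polymat.Φ₁ F₁ u) (Polymat.Φ₂ F₂ v))) ∧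
        ∃ c : Finset (Polymat.Ground₁ ⊕ Polymat.Ground₂) → ℝ,
          Polymat.IsSubspaceRankInequality c ∧
          Polymat.linearForm c
            (Polymat.perturb ε (Polymat.directSum (Polymat.Φ₁ F₁ u) (Polymat.Φ₂ F₂ v))) < 0) := by
  refine ⟨?_, ?_, ?_⟩
  · obtain ⟨h, c, hI, hc, hneg⟩ := Polymat.exists_isIngletonian_linearForm_neg
    exact ⟨_, inferInstance, inferInstance, h, hI,
      Polymat.not_isCCRepresentable_of_linearForm_neg hc hneg⟩
  · obtain ⟨h, c, hI, hc, hneg⟩ := Polymat.exists_isIngletonian_linearForm_neg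
    exact ⟨_, inferInstance, inferInstance, c, hc, fun H => hneg.not_ge (H h hI)⟩
  · intro F₁ W₁ F₂ W₂ _ _ _ _ _ _ u v ε hF₁ hF₂ hu hv hε hε'
    obtain ⟨c, hc, hneg⟩ :=
      Polymat.exists_isSubspaceRankInequality_linearForm_neg hF₁ hF₂ hu hv hε hε'
    exact ⟨Polymat.isIngletonian_perturb_directSum_Φ hε',
      Polymat.not_isCCRepresentable_of_linearForm_neg hc hneg, c, hc, hneg⟩

theorem mainTheorem1 :
    -- some Ingletonian polymatroid is not cc-representable
    (∃ (X : Type) (_ : Fintype X) (_ : DecidableEq X) (h : Polymat.RankFun X),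
      Polymat.IsIngletonian h ∧ ¬ Polymat.IsCCRepresentable h) ∧
    -- some linear inequality valid for all representable polymatroids
    -- is not implied by Ingleton's inequalities
    (∃ (X : Type) (_ : Fintype X) (_ : DecidableEq X) (c : Finset X → ℝ),
      Polymat.IsSubspaceRankInequality c ∧ ¬ Polymat.IsImpliedByIngleton c) ∧
    -- the witness
    (∀ (F₁ W₁ F₂ W₂ : Type) [Field F₁] [Finite F₁] [AddCommGroup W₁] [Module F₁ W₁]
      [Field F₂] [Finite F₂] [AddCommGroup W₂] [Module F₂ W₂]
      (u : Fin 3 → W₁) (v : Fin 5 → W₂) (ε : ℝ),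
      CharP F₁ 2 → Odd (ringChar F₂) →
      LinearIndependent F₁ u → LinearIndependent F₂ v →
      0 < ε → ε ≤ min (Polymat.Φ₁ F₁ u Finset.univ) (Polymat.Φ₂ F₂ v Finset.univ) →
      Polymat.IsIngletonian
          (Polymat.perturb ε (Polymat.directSum (Polymat.Φ₁ F₁ u) (Polymat.Φ₂ F₂ v))) ∧
        ¬ Polymat.IsCCRepresentable
          (Polymat.perturb ε (Polymat.directSum (Polymat.Φ₁ F₁ u) (Polymat.Φ₂ F₂ v))) ∧
        ∃ c : Finset (Polymat.Ground₁ ⊕ Polymat.Ground₂) → ℝ,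
          Polymat.IsSubspaceRankInequality c ∧
          Polymat.linearForm c
            (Polymat.perturb ε (Polymat.directSum (Polymat.Φ₁ F₁ u) (Polymat.Φ₂ F₂ v))) < 0) :=
  mainTheorem1_general.imp_right <| And.imp_right fun H F₁ W₁ F₂ W₂ _ _ _ _ _ _ _ _ u v ε h₁ h₂ =>
    H F₁ W₁ F₂ W₂ u v ε (CharP.cast_eq_zero F₁ 2)
      (Ring.two_ne_zero fun h => absurd (h ▸ h₂) (by decide))
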